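/- There are positive numerical constants $c, c'$ and a numerical constant $d_0$ such that the following holds for every even number $m\ge 2$ of machines, every dimension $d>d_0$, and all reals $\delta,\lambda$ with $\delta\ge 3\lambda>0$. Machine $i\in\{1,\dots,m\}$ holds a local quadratic function $F_i(w)=w^\top A_i w+b_i^\top w+c_i$ on $\mathbb{R}^d$, where $A_i$ is a symmetric positive semidefinite matrix, $b_i\in\mathbb{R}^d$ and $c_i\in\mathbb{R}$; put $F=\frac1m\sum_{i=1}^m F_i$. The functions are called $\delta$-related if $\|A_i-A_j\|\le\delta$ (spectral norm), $\|b_i-b_j\|\le\delta$ (Euclidean norm) and $|c_i-c_j|\le\delta$ for all $i,j$. A function is $L$-smooth if it is differentiable with $L$-Lipschitz gradient. A (possibly randomized) one-round algorithm works as follows: each machine broadcasts one finite string of bits, computed from its own local function and a random seed (which may be shared by all machines), and then one designated machine, fixed in advance, outputs a point $\hat w\in\mathbb{R}^d$ computed from its own local function, all the messages and the seed; no restriction is put on local computation. Consider any such algorithm whose messages have total length, summed over all machines, at most $d^2/128$ bits, for every value of the seed and for every $\delta$-related family of $\lambda$-strongly convex and $9\lambda$-smooth local quadratic functions. Then there exist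 $m$ quadratic functions $F_1,\dots,F_m$ over $\mathbb{R}^d$ which are $\delta$-related, $\lambda$-strongly convex and $9\lambda$-smooth, such that both of the following hold. 1. The point $\hat w$ returned by the algorithm on $F_1,\dots,F_m$ satisfies $$\mathbb{E}\Big[F(\hat w)-\min_{w\in\mathbb{R}^d}F(w)\Big]\ \ge\ c\,\frac{\delta^2}{\lambda},$$ where the expectation (possibly $+\infty$) is over the algorithm's randomness. 2. For every machine $j$, the function $F_j$ has a minimizer, and $\hat w_j=\arg\min_{w\in\mathbb{R}^d}F_j(w)$ satisfies $$F(\hat w_j)-\min_{w\in\mathbb{R}^d}F(w)\ \le\ c'\,\frac{\delta^2}{\lambda}.$$ -/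

import Mathlib

/-- A quadratic function `w ↦ wᵀ A w + bᵀ w + c` on `ℝ^d`, with `A` (symmetric) positive
semidefinite, given by its coefficients. -/
structure QuadraticFn (d : ℕ) where
  A : Matrix (Fin d) (Fin d) ℝ
  b : EuclideanSpace ℝ (Fin d)
  c : ℝ
  posSemidef : A.PosSemidef

/-- The value of the quadratic function at a point. -/
noncomputable def QuadraticFn.eval {d : ℕ} (q : QuadraticFn d)
    (w : EuclideanSpace ℝ (Fin d)) : ℝ :=
  w.ofLp ⬝ᵥ (q.A.mulVec w.ofLp) + inner ℝ q.b w + q.c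

/-- The spectral norm of a real square matrix: its operator norm for the Euclidean norm. -/
noncomputable def spectralNorm2 {d : ℕ} (A : Matrix (Fin d) (Fin d) ℝ) : ℝ :=
  ‖Matrix.toEuclideanCLM (n := Fin d) (𝕜 := ℝ) A‖

/-- `δ`-related families of quadratic functions. -/
def IsRelated {m d : ℕ} (δ : ℝ) (F : Fin m → QuadraticFn d) : Prop :=
  ∀ i j, spectralNorm2 ((F i).A - (F j).A) ≤ δ ∧ ‖(F i).b - (F j).b‖ ≤ δ ∧
    |(F i).c - (F j).c| ≤ δ

/-- `G` is smooth with parameter `L`: differentiable with `L`-Lipschitz gradient. -/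
def IsSmoothWith {d : ℕ} (L : ℝ) (G : EuclideanSpace ℝ (Fin d) → ℝ) : Prop :=
  Differentiable ℝ G ∧ ∀ x y, ‖gradient G x - gradient G y‖ ≤ L * ‖x - y‖

/-- The admissible inputs: `δ`-related families of local quadratic functions, each of which is
`lam`-strongly convex and `L`-smooth. -/
def IsAdmissible {m d : ℕ} (δ lam L : ℝ) (F : Fin m → QuadraticFn d) : Prop :=
  IsRelated δ F ∧ ∀ i, StrongConvexOn Set.univ lam (F i).eval ∧ IsSmoothWith L (F i).eval

/-- The global objective: the average of the local functions. -/
noncomputable def averageFn {m d : ℕ} (F : Fin m → QuadraticFn d)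
    (w : EuclideanSpace ℝ (Fin d)) : ℝ :=
  (1 / (m : ℝ)) * ∑ i, (F i).eval w

/-- A one-round distributed algorithm for `m` machines, with random seed in `Ω` (visible to all
machines; independent private coins are the case of a product space). In its only round machine
`i` broadcasts a finite string of bits, computed from its own local function and the seed.
The designated machine then outputs a point, computed from its own local function, all the
messages and the seed. -/
structure OneRoundAlgorithm (m d : ℕ) (Ω : Type*) where
  message : Fin m → QuadraticFn d → Ω → List Bool
  designated : Fin m
  output : QuadraticFn d → (Fin m → List Bool) → Ω → EuclideanSpace ℝ (Fin d)

/-- The point returned by the algorithm on the local functions `F` with the seed `ω`. -/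
def OneRoundAlgorithm.run {m d : ℕ} {Ω : Type*} (alg : OneRoundAlgorithm m d Ω)
    (F : Fin m → QuadraticFn d) (ω : Ω) : EuclideanSpace ℝ (Fin d) :=
  alg.output (F alg.designated) (fun i => alg.message i (F i) ω) ω

/-- The total number of bits communicated by all machines. -/
def OneRoundAlgorithm.bits {m d : ℕ} {Ω : Type*} (alg : OneRoundAlgorithm m d Ω)
    (F : Fin m → QuadraticFn d) (ω : Ω) : ℕ :=
  ∑ i, (alg.message i (F i) ω).length

/-! The lower bound hides a symmetric sign matrix in the local functions and asks the algorithm for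
one of its columns. Half of the machines, the designated one excluded, hold the form `2λ(1 + 2R)`;
the others hold `2λ‖w‖² + ⟨δ e_j, w⟩`. Their average is minimized at `-(δ/8λ)(1 + R)⁻¹ e_j`. Here
`R` is chosen so that `(1 + R)⁻¹ = 1 + S`, where `S` is a sign matrix scaled by `1/(96√d)`, so the
minimizer displays column `j` of the signs. At least half of the sign choices give `‖S‖ ≤ 1/4`
(`card_upperSign_norm_gt_le`), which yields `‖R‖ ≤ 1/3` and keeps the functions admissible.

The first group does not know `j`, so its messages must serve every `j` at once: running the output
rule for each `j` on one joint message decodes all `n ≥ d²/4` signs. At most `4^(d²/128)` joint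
messages exist (`exists_codebook`), and each decoded vector is close to few sign vectors
(`card_signs_near_le`). Hence the mean squared error is of order `n` (`sum_decoding_error_ge`),
which after rescaling is a gap of order `δ²/λ` per column (`sum_gap_ge`). Averaging over signs and
columns, then over the seed, fixes one bad family.

For the upper bound, the local and global minimizers all have norm at most `δ/(2λ)`, and the average
has curvature of order `λ`. -/

/-! ### Convexity and smoothness of quadratic functions -/

open scoped RealInnerProductSpace in
/-- The quadratic form of the Euclidean operator attached to the matrix of a quadratic function. -/
theorem QuadraticFn.eval_eq_inner {d : ℕ} (q : QuadraticFn d) (w : EuclideanSpace ℝ (Fin d)) :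
    q.eval w = ⟪w, Matrix.toEuclideanCLM (n := Fin d) (𝕜 := ℝ) q.A w⟫ + ⟪q.b, w⟫ + q.c := by
  rw [Matrix.inner_toEuclideanCLM]; rfl

theorem QuadraticFn.isSelfAdjoint {d : ℕ} (q : QuadraticFn d) :
    IsSelfAdjoint (Matrix.toEuclideanCLM (n := Fin d) (𝕜 := ℝ) q.A) :=
  IsSelfAdjoint.map (q.posSemidef.isHermitian : IsSelfAdjoint q.A) _

open scoped RealInnerProductSpace in
theorem IsSelfAdjoint.inner_apply_comm {E : Type*} [NormedAddCommGroup E] [InnerProductSpace ℝ E]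
    [CompleteSpace E] {T : E →L[ℝ] E} (hT : IsSelfAdjoint T) (x y : E) :
    ⟪x, T y⟫ = ⟪y, T x⟫ := by
  have := hT.isSymmetric y x
  simp only [ContinuousLinearMap.coe_coe] at this
  rw [← this, real_inner_comm]

open scoped RealInnerProductSpace in
theorem QuadraticFn.strongConvexOn {d : ℕ} (q : QuadraticFn d) {lam : ℝ}
    (h : ∀ x, lam / 2 * ‖x‖ ^ 2 ≤ ⟪x, Matrix.toEuclideanCLM (n := Fin d) (𝕜 := ℝ) q.A x⟫) :
    StrongConvexOn Set.univ lam q.eval := by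
  refine ⟨convex_univ, fun x _ y _ a b ha hb hab => ?_⟩
  have h1 := h (x - y)
  have h2 := mul_le_mul_of_nonneg_left h1 (mul_nonneg ha hb)
  simp only [QuadraticFn.eval_eq_inner, map_add, map_smul, map_sub, inner_add_left,
    inner_add_right, inner_smul_left, inner_smul_right, inner_sub_left, inner_sub_right,
    smul_eq_mul, conj_trivial] at h2 ⊢
  rw [q.isSelfAdjoint.inner_apply_comm y x] at *
  obtain rfl : b = 1 - a := by linarith
  linarith

open scoped RealInnerProductSpace in
theorem QuadraticFn.hasGradientAt {d : ℕ} (q : QuadraticFn d) (x : EuclideanSpace ℝ (Fin d)) :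
    HasGradientAt q.eval
      ((2 : ℝ) • Matrix.toEuclideanCLM (n := Fin d) (𝕜 := ℝ) q.A x + q.b) x := by
  have he : q.eval = fun w => ⟪w, Matrix.toEuclideanCLM (n := Fin d) (𝕜 := ℝ) q.A w⟫ +
      ⟪q.b, w⟫ + q.c := funext q.eval_eq_inner
  rw [hasGradientAt_iff_hasFDerivAt, he]
  have h1 := ((hasFDerivAt_id x).inner ℝ
    (Matrix.toEuclideanCLM (n := Fin d) (𝕜 := ℝ) q.A).hasFDerivAt)
  have h2 := ((hasFDerivAt_const q.b x).inner ℝ (hasFDerivAt_id x))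
  refine ((h1.add h2).add_const q.c).congr_fderiv ?_
  ext v
  simp [fderivInnerCLM_apply]
  rw [q.isSelfAdjoint.inner_apply_comm x v, real_inner_comm v]
  ring

theorem QuadraticFn.isSmoothWith {d : ℕ} (q : QuadraticFn d) {L : ℝ}
    (h : spectralNorm2 q.A ≤ L / 2) : IsSmoothWith L q.eval := by
  refine ⟨fun x => (q.hasGradientAt x).differentiableAt, fun x y => ?_⟩
  rw [(q.hasGradientAt x).gradient, (q.hasGradientAt y).gradient, add_sub_add_right_eq_sub,
    ← smul_sub, ← map_sub, norm_smul]
  have := (Matrix.toEuclideanCLM (n := Fin d) (𝕜 := ℝ) q.A).le_of_opNorm_le h (x - y)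
  simp only [Real.norm_ofNat]
  linarith

/-! ### Perturbations of the identity and the hard quadratics -/

/-- The inverse of a small self-adjoint perturbation of the identity is again one. -/
theorem exists_selfAdjoint_inverse {E : Type*} [NormedAddCommGroup E] [InnerProductSpace ℝ E]
    [CompleteSpace E] {T : E →L[ℝ] E} (hT : IsSelfAdjoint T) (hn : ‖T‖ ≤ 1 / 4) :
    ∃ R : E →L[ℝ] E, IsSelfAdjoint R ∧ ‖R‖ ≤ 1 / 3 ∧ (1 + R) * (1 + T) = 1 := by
  obtain ⟨u, hu⟩ : IsUnit (1 + T) := by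
    have := (Units.oneSub (-T) (by rw [norm_neg]; linarith)).isUnit
    simpa using this
  have hs : IsSelfAdjoint (u : E →L[ℝ] E) := by
    rw [hu]; exact (IsSelfAdjoint.one _).add hT
  have hs' : IsSelfAdjoint ((u⁻¹ : (E →L[ℝ] E)ˣ) : E →L[ℝ] E) := by
    have : IsSelfAdjoint u := Units.ext hs
    exact congrArg Units.val this.inv
  have hTu : T = u - 1 := by rw [hu]; abel
  refine ⟨((u⁻¹ : (E →L[ℝ] E)ˣ) : E →L[ℝ] E) - 1, hs'.sub (IsSelfAdjoint.one _), ?_, ?_⟩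
  · set S : E →L[ℝ] E := ((u⁻¹ : (E →L[ℝ] E)ˣ) : E →L[ℝ] E) with hS
    have hTS : T * S = 1 - S := by rw [hTu, sub_mul, hS, Units.mul_inv, one_mul]
    refine ContinuousLinearMap.opNorm_le_bound _ (by norm_num) fun x => ?_
    -- With `u = ‖x - S x‖` this gives `u ≤ (‖x‖ + u) / 4`, hence `u ≤ ‖x‖ / 3`.
    have h1 : T (S x) = x - S x := DFunLike.congr_fun hTS x
    have h2 := T.le_of_opNorm_le hn (S x)
    have h3 : ‖S x‖ ≤ ‖x‖ + ‖x - S x‖ := by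
      have := norm_sub_le x (x - S x)
      simpa using this
    have h4 : ‖(S - 1) x‖ = ‖x - S x‖ := by
      rw [norm_sub_rev]; rfl
    rw [h4]
    rw [h1] at h2
    linarith
  · rw [← hu]; simp

theorem IsSelfAdjoint.smul_one_add_smul {E : Type*} [NormedAddCommGroup E]
    [InnerProductSpace ℝ E] [CompleteSpace E] {R : E →L[ℝ] E} (hR : IsSelfAdjoint R) (a b : ℝ) :
    IsSelfAdjoint (a • (1 + b • R)) :=
  IsSelfAdjoint.smul (IsSelfAdjoint.all _)
    ((IsSelfAdjoint.one _).add (IsSelfAdjoint.smul (IsSelfAdjoint.all _) hR))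

/-- The self-adjoint operators of norm at most `1 / 3`. -/
def SmallSelfAdjoint (d : ℕ) : Type :=
  {R : EuclideanSpace ℝ (Fin d) →L[ℝ] EuclideanSpace ℝ (Fin d) // IsSelfAdjoint R ∧ ‖R‖ ≤ 1 / 3}

open scoped RealInnerProductSpace in
theorem SmallSelfAdjoint.abs_inner_le {d : ℕ} (R : SmallSelfAdjoint d)
    (x : EuclideanSpace ℝ (Fin d)) : |⟪x, R.1 x⟫| ≤ 1 / 3 * ‖x‖ ^ 2 := by
  have h1 := abs_real_inner_le_norm x (R.1 x)
  have h2 := R.1.le_of_opNorm_le R.2.2 x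
  nlinarith [norm_nonneg x]

/-- The operator `2 lam (1 + 2 R)`. -/
noncomputable def hessianOp {d : ℕ} (lam : ℝ) (R : SmallSelfAdjoint d) :
    EuclideanSpace ℝ (Fin d) →L[ℝ] EuclideanSpace ℝ (Fin d) :=
  (2 * lam) • (1 + (2 : ℝ) • R.1)

open scoped RealInnerProductSpace in
theorem inner_hessianOp {d : ℕ} (lam : ℝ) (R : SmallSelfAdjoint d)
    (x : EuclideanSpace ℝ (Fin d)) :
    ⟪x, hessianOp lam R x⟫ = 2 * lam * ‖x‖ ^ 2 + 4 * lam * ⟪x, R.1 x⟫ := by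
  simp only [hessianOp, smul_apply, add_apply,
    one_apply_eq_self, inner_smul_right, inner_add_right, real_inner_self_eq_norm_sq]
  ring

-- Since `1 + 2R ≥ 1/3`, the form is at least `2λ/3`. The target is `λ/2` because the Hessian is
-- twice the matrix.
open scoped RealInnerProductSpace in
theorem hessianOp_lower {d : ℕ} {lam : ℝ} (hlam : 0 ≤ lam) (R : SmallSelfAdjoint d)
    (x : EuclideanSpace ℝ (Fin d)) : lam / 2 * ‖x‖ ^ 2 ≤ ⟪x, hessianOp lam R x⟫ := by
  rw [inner_hessianOp]
  have := (abs_le.1 (R.abs_inner_le x)).1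
  nlinarith [mul_le_mul_of_nonneg_left this hlam, mul_nonneg hlam (sq_nonneg ‖x‖)]

/-- The quadratic function with Hessian `4 lam (1 + 2 R)` and linear term `b`. -/
noncomputable def hardQuadratic {d : ℕ} {lam : ℝ} (hlam : 0 ≤ lam) (R : SmallSelfAdjoint d)
    (b : EuclideanSpace ℝ (Fin d)) : QuadraticFn d where
  A := (Matrix.toEuclideanCLM (n := Fin d) (𝕜 := ℝ)).symm (hessianOp lam R)
  b := b
  c := 0
  posSemidef := by
    have hs : IsSelfAdjoint (hessianOp lam R) := R.2.1.smul_one_add_smul (2 * lam) 2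
    have hA : IsSelfAdjoint ((Matrix.toEuclideanCLM (n := Fin d) (𝕜 := ℝ)).symm
      (hessianOp lam R)) := by
      refine EquivLike.injective (Matrix.toEuclideanCLM (n := Fin d) (𝕜 := ℝ)) ?_
      rw [map_star, StarAlgEquiv.apply_symm_apply, hs.star_eq]
    refine Matrix.PosSemidef.of_dotProduct_mulVec_nonneg hA fun x => ?_
    have h := hessianOp_lower hlam R (WithLp.toLp 2 x)
    rw [← StarAlgEquiv.apply_symm_apply (Matrix.toEuclideanCLM (n := Fin d) (𝕜 := ℝ))
      (hessianOp lam R), Matrix.inner_toEuclideanCLM] at h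
    simp only [star_trivial]
    exact le_trans (by positivity) h

open scoped RealInnerProductSpace in
theorem hardQuadratic_eval {d : ℕ} {lam : ℝ} (hlam : 0 ≤ lam) (R : SmallSelfAdjoint d)
    (b w : EuclideanSpace ℝ (Fin d)) :
    (hardQuadratic hlam R b).eval w =
      2 * lam * ‖w‖ ^ 2 + 4 * lam * ⟪w, R.1 w⟫ + ⟪b, w⟫ := by
  rw [QuadraticFn.eval_eq_inner]
  simp only [hardQuadratic, StarAlgEquiv.apply_symm_apply, inner_hessianOp, add_zero]

/-- For smoothness, `‖1 + 2R‖ ≤ 5/3` bounds the matrix norm by `10λ/3`, below the required `9λ/2`.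
-/
theorem hardQuadratic_regular {d : ℕ} {lam : ℝ} (hlam : 0 ≤ lam) (R : SmallSelfAdjoint d)
    (b : EuclideanSpace ℝ (Fin d)) :
    StrongConvexOn Set.univ lam (hardQuadratic hlam R b).eval ∧
      IsSmoothWith (9 * lam) (hardQuadratic hlam R b).eval := by
  refine ⟨QuadraticFn.strongConvexOn _ fun x => ?_, QuadraticFn.isSmoothWith _ ?_⟩
  · simpa only [hardQuadratic, StarAlgEquiv.apply_symm_apply] using hessianOp_lower hlam R x
  · simp only [spectralNorm2, hardQuadratic, StarAlgEquiv.apply_symm_apply]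
    refine ContinuousLinearMap.opNorm_le_bound _ (by positivity) fun x => ?_
    have h1 : ‖hessianOp lam R x‖ ≤ 2 * lam * (‖x‖ + 2 * ‖R.1 x‖) := by
      simp only [hessianOp, smul_apply, add_apply,
        one_apply_eq_self, norm_smul]
      rw [Real.norm_of_nonneg (by positivity : 0 ≤ 2 * lam)]
      gcongr
      refine (norm_add_le _ _).trans ?_
      rw [norm_smul, Real.norm_ofNat]
    have h2 := R.1.le_of_opNorm_le R.2.2 x
    nlinarith [mul_le_mul_of_nonneg_left h2 hlam, mul_nonneg hlam (norm_nonneg x)]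

/-- The matrices differ by `4λ(R - R')`, of norm at most `8λ/3`; this is where `δ ≥ 3λ` enters. -/
theorem hardQuadratic_related {d : ℕ} {lam δ : ℝ} (hlam : 0 ≤ lam) (hδ : 3 * lam ≤ δ)
    (R R' : SmallSelfAdjoint d) {b b' : EuclideanSpace ℝ (Fin d)} (hb : ‖b - b'‖ ≤ δ) :
    spectralNorm2 ((hardQuadratic hlam R b).A - (hardQuadratic hlam R' b').A) ≤ δ ∧
      ‖(hardQuadratic hlam R b).b - (hardQuadratic hlam R' b').b‖ ≤ δ ∧
      |(hardQuadratic hlam R b).c - (hardQuadratic hlam R' b').c| ≤ δ := by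
  refine ⟨?_, hb, by simp [hardQuadratic]; linarith⟩
  simp only [spectralNorm2, hardQuadratic, map_sub, StarAlgEquiv.apply_symm_apply]
  have h : hessianOp lam R - hessianOp lam R' = (4 * lam) • (R.1 - R'.1) := by
    simp only [hessianOp]; module
  rw [h, norm_smul, Real.norm_of_nonneg (by positivity)]
  have := norm_sub_le R.1 R'.1
  have h1 := R.2.2
  have h2 := R'.2.2
  nlinarith

/-! ### Exponential moments of random signs -/

/-- The sign attached to a bit. -/
def bitSign (b : Bool) : ℝ := if b then 1 else -1

theorem sum_prod_bits {ι : Type*} [Fintype ι] [DecidableEq ι] (f : ι → Bool → ℝ) :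
    ∑ ε : ι → Bool, ∏ p, f p (ε p) = ∏ p, (f p true + f p false) := by
  have := Finset.prod_univ_sum (fun _ : ι => (Finset.univ : Finset Bool)) f
  rw [Fintype.piFinset_univ] at this
  rw [← this]
  simp

/-- The exponential moment factors over coordinates, and each factor is `2 cosh a ≤ 2 exp (a²/2)`.
-/
theorem sum_exp_signs_le {ι : Type*} [Fintype ι] [DecidableEq ι] (a : ι → ℝ) :
    ∑ ε : ι → Bool, Real.exp (∑ p, a p * bitSign (ε p)) ≤
      2 ^ Fintype.card ι * Real.exp ((∑ p, a p ^ 2) / 2) := by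
  simp only [Real.exp_sum]
  rw [sum_prod_bits (fun p b => Real.exp (a p * bitSign b)), Finset.sum_div, Real.exp_sum,
    Fintype.card, ← Finset.prod_const, ← Finset.prod_mul_distrib]
  refine Finset.prod_le_prod (fun p _ => by positivity) fun p _ => ?_
  have h := Real.cosh_le_exp_half_sq (a p)
  rw [Real.cosh_eq] at h
  simp only [bitSign, if_true, Bool.false_eq_true, if_false, mul_one, mul_neg]
  linarith

/-- Chernoff's bound for sums of independent signs, in counting form. -/
theorem card_signs_ge_le {ι : Type*} [Fintype ι] [DecidableEq ι] (a : ι → ℝ)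
    (ha : ∑ p, a p ^ 2 ≤ 1) {t : ℝ} (ht : 0 ≤ t) :
    ((Finset.univ.filter fun ε : ι → Bool => t ≤ ∑ p, a p * bitSign (ε p)).card : ℝ) ≤
      2 ^ Fintype.card ι * Real.exp (-(t ^ 2 / 2)) := by
  set B := Finset.univ.filter fun ε : ι → Bool => t ≤ ∑ p, a p * bitSign (ε p)
  -- Markov's inequality with exponential parameter `t`, the optimal one when `∑ a² = 1`.
  have h1 : (B.card : ℝ) * Real.exp (t ^ 2) ≤
      ∑ ε : ι → Bool, Real.exp (∑ p, (t * a p) * bitSign (ε p)) := by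
    rw [← nsmul_eq_mul, ← Finset.sum_const]
    refine (Finset.sum_le_sum fun ε hε => ?_).trans
      (Finset.sum_le_sum_of_subset_of_nonneg (Finset.subset_univ B)
        fun _ _ _ => (Real.exp_pos _).le)
    have := (Finset.mem_filter.1 hε).2
    simp only [mul_assoc, ← Finset.mul_sum]
    exact Real.exp_le_exp.2 (by nlinarith)
  have h2 := h1.trans (sum_exp_signs_le fun p => t * a p)
  have h3 : Real.exp ((∑ p, (t * a p) ^ 2) / 2) ≤ Real.exp (t ^ 2 / 2) := by
    simp only [mul_pow, ← Finset.mul_sum]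
    exact Real.exp_le_exp.2 (by nlinarith [sq_nonneg t])
  have h4 : Real.exp (t ^ 2 / 2) = Real.exp (-(t ^ 2 / 2)) * Real.exp (t ^ 2) := by
    rw [← Real.exp_add]; ring_nf
  refine le_of_mul_le_mul_right (h2.trans ?_) (Real.exp_pos (t ^ 2))
  rw [mul_assoc, ← h4]
  gcongr

/-! ### Nets and the operator norm -/

/-- A `1/2`-separated set of largest cardinality in the unit ball is a net, since any uncovered
point could be added to it. Separation bounds the cardinality. -/
theorem exists_half_net (E : Type*) [NormedAddCommGroup E] [NormedSpace ℝ E]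
    [FiniteDimensional ℝ E] :
    ∃ N : Finset E, (∀ x ∈ N, ‖x‖ ≤ 1) ∧ N.card ≤ 5 ^ Module.finrank ℝ E ∧
      ∀ x : E, ‖x‖ ≤ 1 → ∃ y ∈ N, ‖x - y‖ ≤ 1 / 2 := by
  classical
  let P : Finset E → Prop := fun s =>
    (∀ x ∈ s, ‖x‖ ≤ 1) ∧ ∀ x ∈ s, ∀ y ∈ s, x ≠ y → 1 / 2 ≤ ‖x - y‖
  have hP : ∀ s, P s → s.card ≤ 5 ^ Module.finrank ℝ E := by
    intro s hs
    -- Doubling turns the set into a `1`-separated one in the ball of radius `2`, the setting of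
    -- `Besicovitch.card_le_of_separated`.
    have hinj : Function.Injective fun x : E => (2 : ℝ) • x :=
      smul_right_injective E two_ne_zero
    rw [← Finset.card_image_of_injective s hinj]
    refine Besicovitch.card_le_of_separated _ ?_ ?_
    · intro c hc
      obtain ⟨x, hx, rfl⟩ := Finset.mem_image.1 hc
      have := hs.1 x hx
      rw [norm_smul, Real.norm_ofNat]
      linarith
    · intro c hc e he hne
      obtain ⟨x, hx, rfl⟩ := Finset.mem_image.1 hc
      obtain ⟨y, hy, rfl⟩ := Finset.mem_image.1 he
      have := hs.2 x hx y hy (fun h => hne (by rw [h]))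
      rw [← smul_sub, norm_smul, Real.norm_ofNat]
      linarith
  have hmem := Nat.sSup_mem (s := {n | ∃ s, P s ∧ s.card = n})
    ⟨0, ∅, ⟨by simp, by simp⟩, rfl⟩ ⟨_, by rintro _ ⟨s, hs, rfl⟩; exact hP s hs⟩
  obtain ⟨N, hN, hcard⟩ := hmem
  refine ⟨N, hN.1, hP N hN, fun x hx => ?_⟩
  by_contra! hcon
  have hxN : x ∉ N := fun h => by have := hcon x h; norm_num at this
  have hP' : P (insert x N) := by
    refine ⟨fun y hy => ?_, fun y hy z hz hyz => ?_⟩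
    · rcases Finset.mem_insert.1 hy with rfl | hy
      exacts [hx, hN.1 y hy]
    · rcases Finset.mem_insert.1 hy with hyx | hyN <;>
        rcases Finset.mem_insert.1 hz with hzx | hzN
      · exact absurd (hyx.trans hzx.symm) hyz
      · rw [hyx]; exact (hcon z hzN).le
      · rw [hzx, norm_sub_rev]; exact (hcon y hyN).le
      · exact hN.2 y hyN z hzN hyz
  have hle : (insert x N).card ≤ sSup {n | ∃ s, P s ∧ s.card = n} :=
    le_csSup ⟨_, by rintro _ ⟨s, hs, rfl⟩; exact hP s hs⟩ ⟨_, hP', rfl⟩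
  rw [Finset.card_insert_of_notMem hxN, ← hcard] at hle
  omega

-- Replacing a unit vector by a net point loses at most half of the norm being estimated, so each of
-- the two arguments of the bilinear form costs a factor `2`.
open scoped RealInnerProductSpace in
theorem opNorm_le_of_half_net {E : Type*} [NormedAddCommGroup E] [InnerProductSpace ℝ E]
    {N : Finset E} (hN : ∀ x : E, ‖x‖ ≤ 1 → ∃ y ∈ N, ‖x - y‖ ≤ 1 / 2)
    (T : E →L[ℝ] E) {M : ℝ} (hM : ∀ x ∈ N, ∀ y ∈ N, ⟪y, T x⟫ ≤ M) : ‖T‖ ≤ 4 * M := by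
  have hvec : ∀ v : E, (∀ y ∈ N, ⟪y, v⟫ ≤ M) → ‖v‖ ≤ 2 * M := by
    intro v hv
    by_cases h0 : v = 0
    · obtain ⟨y, hy, -⟩ := hN 0 (by simp)
      have := hv y hy
      subst h0
      simp only [inner_zero_right] at this
      simpa using this
    · have hpos : 0 < ‖v‖ := norm_pos_iff.2 h0
      obtain ⟨y, hy, hyv⟩ := hN (‖v‖⁻¹ • v) (by
        rw [norm_smul, norm_inv, norm_norm, inv_mul_cancel₀ hpos.ne'])
      have h1 : ⟪‖v‖⁻¹ • v, v⟫ = ‖v‖ := by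
        rw [inner_smul_left, real_inner_self_eq_norm_sq, conj_trivial]
        field_simp
      have h2 := real_inner_le_norm (‖v‖⁻¹ • v - y) v
      rw [inner_sub_left, h1] at h2
      have h3 := hv y hy
      nlinarith
  have hM0 : 0 ≤ M := by
    obtain ⟨x, hx, -⟩ := hN 0 (by simp)
    have := (norm_nonneg _).trans (hvec (T x) (hM x hx))
    linarith
  suffices ‖T‖ ≤ 2 * M + ‖T‖ / 2 by linarith
  refine ContinuousLinearMap.opNorm_le_of_unit_norm (by positivity) fun x hx => ?_
  obtain ⟨y, hy, hxy⟩ := hN x hx.le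
  have h1 := hvec (T y) (hM y hy)
  have h2 := T.le_opNorm (x - y)
  have h3 : ‖T x‖ ≤ ‖T y‖ + ‖T (x - y)‖ := by
    rw [map_sub]
    have := norm_add_le (T y) (T x - T y)
    simpa using this
  nlinarith [norm_nonneg T]

/-! ### Triangular sign matrices -/

/-- The positions strictly above the diagonal. -/
abbrev UpperPair (d : ℕ) : Type := {p : Fin d × Fin d // p.1 < p.2}

theorem sum_upperPair {d : ℕ} (f : UpperPair d → ℝ) :
    ∑ p, f p = ∑ j, ∑ i, if h : i < j then f ⟨(i, j), h⟩ else 0 := by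
  rw [Finset.sum_comm, ← Fintype.sum_prod_type'
    (f := fun i j => if h : i < j then f ⟨(i, j), h⟩ else 0)]
  rw [← Finset.sum_filter_of_ne (p := fun p : Fin d × Fin d => p.1 < p.2)]
  · rw [Finset.sum_subtype (p := fun p : Fin d × Fin d => p.1 < p.2) _ (by simp)]
    refine Finset.sum_congr rfl fun p _ => ?_
    rw [dif_pos p.2]
  · intro p _ hp
    by_contra h
    exact hp (dif_neg h)

theorem card_upperPair_lower {d : ℕ} (hd : 2 ≤ d) :
    (d : ℝ) ^ 2 / 4 ≤ Fintype.card (UpperPair d) := by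
  have h1 : ((Fintype.card (UpperPair d) : ℕ) : ℝ) = ∑ j : Fin d, ((j : ℕ) : ℝ) := by
    have := sum_upperPair (d := d) (fun _ => 1)
    rw [Finset.sum_const, Finset.card_univ, nsmul_one] at this
    rw [this]
    refine Finset.sum_congr rfl fun j _ => ?_
    simp only [dite_eq_ite, Finset.sum_boole]
    rw [Finset.filter_gt_eq_Iio, Fin.card_Iio]
  rw [h1, Fin.sum_univ_eq_sum_range (fun i => (i : ℝ))]
  have h2 : ∀ n : ℕ, ∑ i ∈ Finset.range n, (i : ℝ) = n * (n - 1) / 2 := by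
    intro n
    induction n with
    | zero => simp
    | succ k ih => rw [Finset.sum_range_succ, ih]; push_cast; ring
  rw [h2]
  have : (2 : ℝ) ≤ d := by exact_mod_cast hd
  nlinarith

/-- The strictly upper triangular matrix with given signs. -/
def upperSignMatrix {d : ℕ} (ε : UpperPair d → Bool) : Matrix (Fin d) (Fin d) ℝ :=
  Matrix.of fun i j => if h : i < j then bitSign (ε ⟨(i, j), h⟩) else 0

open scoped RealInnerProductSpace in
theorem inner_upperSignMatrix {d : ℕ} (ε : UpperPair d → Bool) (x y : EuclideanSpace ℝ (Fin d)) :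
    ⟪y, Matrix.toEuclideanCLM (n := Fin d) (𝕜 := ℝ) (upperSignMatrix ε) x⟫ =
      ∑ p, (y p.1.1 * x p.1.2) * bitSign (ε p) := by
  rw [Matrix.inner_toEuclideanCLM, sum_upperPair, Finset.sum_comm]
  simp only [dotProduct, Matrix.mulVec, Finset.mul_sum]
  refine Finset.sum_congr rfl fun i _ => Finset.sum_congr rfl fun j _ => ?_
  simp only [upperSignMatrix, Matrix.of_apply]
  split_ifs
  · ring
  · ring

theorem sum_upperPair_sq_le {d : ℕ} (x y : EuclideanSpace ℝ (Fin d)) (hx : ‖x‖ ≤ 1)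
    (hy : ‖y‖ ≤ 1) : ∑ p : UpperPair d, (y p.1.1 * x p.1.2) ^ 2 ≤ 1 := by
  have h1 : ∑ p : UpperPair d, (y p.1.1 * x p.1.2) ^ 2 ≤ ‖x‖ ^ 2 * ‖y‖ ^ 2 := by
    rw [sum_upperPair, EuclideanSpace.real_norm_sq_eq, EuclideanSpace.real_norm_sq_eq,
      Finset.sum_mul_sum]
    refine Finset.sum_le_sum fun j _ => Finset.sum_le_sum fun i _ => ?_
    split_ifs
    · exact le_of_eq (by ring)
    · positivity
  have h2 : ‖x‖ ^ 2 ≤ 1 := by nlinarith [norm_nonneg x]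
  have h3 : ‖y‖ ^ 2 ≤ 1 := by nlinarith [norm_nonneg y]
  nlinarith [sq_nonneg ‖x‖, sq_nonneg ‖y‖]

open scoped RealInnerProductSpace in
/-- At least half of the triangular sign matrices have norm at most `12 √d`. -/
theorem card_upperSign_norm_gt_le {d : ℕ} (hd : 1 ≤ d) :
    ((Finset.univ.filter fun ε : UpperPair d → Bool =>
      ¬ ‖Matrix.toEuclideanCLM (n := Fin d) (𝕜 := ℝ) (upperSignMatrix ε)‖ ≤ 12 * √d).card : ℝ) ≤
      2 ^ Fintype.card (UpperPair d) / 2 := by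
  classical
  obtain ⟨N, hN1, hNc, hN⟩ := exists_half_net (EuclideanSpace ℝ (Fin d))
  rw [finrank_euclideanSpace_fin] at hNc
  let B : EuclideanSpace ℝ (Fin d) × EuclideanSpace ℝ (Fin d) → Finset (UpperPair d → Bool) :=
    fun z => Finset.univ.filter fun ε =>
      3 * √d ≤ ∑ p : UpperPair d, (z.2 p.1.1 * z.1 p.1.2) * bitSign (ε p)
  have hsub : (Finset.univ.filter fun ε : UpperPair d → Bool =>
      ¬ ‖Matrix.toEuclideanCLM (n := Fin d) (𝕜 := ℝ) (upperSignMatrix ε)‖ ≤ 12 * √d) ⊆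
      (N ×ˢ N).biUnion B := by
    intro ε hε
    by_contra hcon
    refine (Finset.mem_filter.1 hε).2 ?_
    have := opNorm_le_of_half_net hN (Matrix.toEuclideanCLM (n := Fin d) (𝕜 := ℝ)
      (upperSignMatrix ε)) (M := 3 * √d) fun x hx y hy => ?_
    · linarith
    · by_contra! hlt
      refine hcon (Finset.mem_biUnion.2 ⟨(x, y), Finset.mk_mem_product hx hy, ?_⟩)
      rw [inner_upperSignMatrix] at hlt
      exact Finset.mem_filter.2 ⟨Finset.mem_univ _, hlt.le⟩
  have hB : ∀ z ∈ N ×ˢ N, ((B z).card : ℝ) ≤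
      2 ^ Fintype.card (UpperPair d) * Real.exp (-(9 / 2)) ^ d := by
    intro z hz
    obtain ⟨hz1, hz2⟩ := Finset.mem_product.1 hz
    refine (card_signs_ge_le _ (sum_upperPair_sq_le z.1 z.2 (hN1 _ hz1) (hN1 _ hz2))
      (by positivity)).trans (le_of_eq ?_)
    rw [← Real.exp_nat_mul, mul_pow, Real.sq_sqrt (by positivity)]
    ring_nf
  have h1 : ((Finset.univ.filter fun ε : UpperPair d → Bool =>
      ¬ ‖Matrix.toEuclideanCLM (n := Fin d) (𝕜 := ℝ) (upperSignMatrix ε)‖ ≤ 12 * √d).card : ℝ) ≤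
      ∑ z ∈ N ×ˢ N, ((B z).card : ℝ) := by
    exact_mod_cast (Finset.card_le_card hsub).trans Finset.card_biUnion_le
  have h2 := h1.trans (Finset.sum_le_sum hB)
  rw [Finset.sum_const, nsmul_eq_mul, Finset.card_product] at h2
  have h3 : ((N.card * N.card : ℕ) : ℝ) ≤ 25 ^ d := by
    have : (N.card : ℝ) ≤ 5 ^ d := by exact_mod_cast hNc
    push_cast
    calc (N.card : ℝ) * N.card ≤ 5 ^ d * 5 ^ d := by gcongr
      _ = 25 ^ d := by rw [← mul_pow]; norm_num
  -- The threshold `3√d` makes each of the at most `25 ^ d` net pairs fail with probability at most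
  -- `exp (-9/2) ^ d`; this estimate leaves `2 ^ (-d)` in the union bound.
  have h4 : Real.exp (-(9 / 2)) ≤ 1 / 50 := by
    rw [Real.exp_neg, one_div]
    refine inv_anti₀ (by norm_num) ?_
    have h5 : (2.7 : ℝ) ≤ Real.exp 1 := by
      have := Real.exp_one_gt_d9; norm_num at this ⊢; linarith
    have h6 : Real.exp 4 = Real.exp 1 ^ 4 := by rw [← Real.exp_nat_mul]; norm_num
    calc (50 : ℝ) ≤ 2.7 ^ 4 := by norm_num
      _ ≤ Real.exp 1 ^ 4 := by gcongr
      _ = Real.exp 4 := h6.symm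
      _ ≤ Real.exp (9 / 2) := Real.exp_le_exp.2 (by norm_num)
  refine h2.trans ?_
  calc ((N.card * N.card : ℕ) : ℝ) * (2 ^ Fintype.card (UpperPair d) * Real.exp (-(9 / 2)) ^ d)
      ≤ 25 ^ d * (2 ^ Fintype.card (UpperPair d) * (1 / 50) ^ d) := by gcongr
    _ = 2 ^ Fintype.card (UpperPair d) * (1 / 2) ^ d := by
      rw [mul_left_comm, ← mul_pow]; norm_num
    _ ≤ 2 ^ Fintype.card (UpperPair d) * (1 / 2) ^ 1 := by
      gcongr ?_ * ?_
      exact pow_le_pow_of_le_one (by norm_num) (by norm_num) hd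
    _ = _ := by ring

/-! ### Decoding signs from short codes -/

/-- The sign farther from `x` is at distance at least `1`, so its term is at most `exp (-3) ≤ 1/20`;
the other is at most `1`. -/
theorem exp_neg_sq_add_exp_neg_sq_le (x : ℝ) :
    Real.exp (-(3 * (x - 1) ^ 2)) + Real.exp (-(3 * (x + 1) ^ 2)) ≤ Real.exp (1 / 20) := by
  have h5 : (2.718 : ℝ) ≤ Real.exp 1 := by
    have := Real.exp_one_gt_d9; norm_num at this ⊢; linarith
  have h6 : Real.exp (-3) ≤ 1 / 20 := by
    rw [Real.exp_neg, one_div]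
    refine inv_anti₀ (by norm_num) ?_
    calc (20 : ℝ) ≤ 2.718 ^ 3 := by norm_num
      _ ≤ Real.exp 1 ^ 3 := by gcongr
      _ = Real.exp 3 := by rw [← Real.exp_nat_mul]; norm_num
  have h7 := Real.add_one_le_exp (1 / 20 : ℝ)
  rcases le_total 0 x with hx | hx
  · have h1 : Real.exp (-(3 * (x - 1) ^ 2)) ≤ 1 :=
      Real.exp_le_one_iff.2 (by nlinarith [sq_nonneg (x - 1)])
    have h2 : Real.exp (-(3 * (x + 1) ^ 2)) ≤ Real.exp (-3) :=
      Real.exp_le_exp.2 (by nlinarith)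
    linarith
  · have h1 : Real.exp (-(3 * (x + 1) ^ 2)) ≤ 1 :=
      Real.exp_le_one_iff.2 (by nlinarith [sq_nonneg (x + 1)])
    have h2 : Real.exp (-(3 * (x - 1) ^ 2)) ≤ Real.exp (-3) :=
      Real.exp_le_exp.2 (by nlinarith)
    linarith

/-- Few sign vectors are close to a given real vector. -/
theorem card_signs_near_le {ι : Type*} [Fintype ι] [DecidableEq ι] (g : ι → ℝ) :
    ((Finset.univ.filter fun ε : ι → Bool =>
      ∑ p, (g p - bitSign (ε p)) ^ 2 ≤ (Fintype.card ι : ℝ) / 10).card : ℝ) ≤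
      Real.exp (7 / 20 * Fintype.card ι) := by
  set n : ℝ := (Fintype.card ι : ℝ) with hn
  set B := Finset.univ.filter fun ε : ι → Bool => ∑ p, (g p - bitSign (ε p)) ^ 2 ≤ n / 10
  -- Markov's inequality with weight `exp (-3 · dist²)`. The exponents `3/10` and `1/20` add up to
  -- `7/20`.
  have h1 : (B.card : ℝ) * Real.exp (-(3 / 10 * n)) ≤
      ∑ ε : ι → Bool, Real.exp (∑ p, -(3 * (g p - bitSign (ε p)) ^ 2)) := by
    rw [← nsmul_eq_mul, ← Finset.sum_const]
    refine (Finset.sum_le_sum fun ε hε => ?_).trans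
      (Finset.sum_le_sum_of_subset_of_nonneg (Finset.subset_univ B)
        fun _ _ _ => (Real.exp_pos _).le)
    have := (Finset.mem_filter.1 hε).2
    rw [Finset.sum_neg_distrib, ← Finset.mul_sum]
    exact Real.exp_le_exp.2 (by linarith)
  have h2 : ∑ ε : ι → Bool, Real.exp (∑ p, -(3 * (g p - bitSign (ε p)) ^ 2)) ≤
      Real.exp (1 / 20 * n) := by
    simp only [Real.exp_sum]
    rw [sum_prod_bits (fun p b => Real.exp (-(3 * (g p - bitSign b) ^ 2))), mul_comm, hn,
      Real.exp_nat_mul, Fintype.card, ← Finset.prod_const]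
    refine Finset.prod_le_prod (fun p _ => by positivity) fun p _ => ?_
    simpa [bitSign] using exp_neg_sq_add_exp_neg_sq_le (g p)
  have h3 := h1.trans h2
  rw [Real.exp_neg, ← div_eq_mul_inv, div_le_iff₀ (Real.exp_pos _), ← Real.exp_add] at h3
  refine h3.trans (le_of_eq ?_)
  ring_nf

/-- In exponents per coordinate, `7/160` for the code and `7/20` for the near vectors leave `29/100`
below `69/100 < log 2`, enough to absorb the factor `4` once `n ≥ 25`. -/
theorem four_pow_mul_exp_le {n B : ℕ} (hn : 25 ≤ n) (hB : (B : ℝ) ≤ n / 32) :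
    (4 : ℝ) ^ B * Real.exp (7 / 20 * n) ≤ 2 ^ n / 4 := by
  have hn' : (25 : ℝ) ≤ n := by exact_mod_cast hn
  have hl := Real.log_two_lt_d9
  have hl' := Real.log_two_gt_d9
  have h1 : (4 : ℝ) ^ B ≤ Real.exp (7 / 160 * n) := by
    have : (4 : ℝ) ^ B = Real.exp (B * (2 * Real.log 2)) := by
      rw [Real.exp_nat_mul, two_mul, Real.exp_add, Real.exp_log two_pos]; norm_num
    rw [this]
    refine Real.exp_le_exp.2 ?_
    nlinarith [Nat.cast_nonneg (α := ℝ) B]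
  have h2 : Real.exp (69 / 100 * n) ≤ 2 ^ n := by
    have : (2 : ℝ) ^ n = Real.exp (n * Real.log 2) := by
      rw [Real.exp_nat_mul, Real.exp_log two_pos]
    rw [this]
    exact Real.exp_le_exp.2 (by nlinarith)
  have h3 : (4 : ℝ) ≤ Real.exp (29 / 100 * n) := by
    have := Real.add_one_le_exp (29 / 100 * (n : ℝ))
    linarith
  have h4 : Real.exp (7 / 160 * n) * Real.exp (7 / 20 * n) * Real.exp (29 / 100 * (n : ℝ)) ≤
      Real.exp (69 / 100 * n) := by
    rw [← Real.exp_add, ← Real.exp_add]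
    exact Real.exp_le_exp.2 (by nlinarith)
  have h5 : (4 : ℝ) ^ B * Real.exp (7 / 20 * n) ≤
      Real.exp (7 / 160 * n) * Real.exp (7 / 20 * n) := by gcongr
  have h6 : 0 < Real.exp (7 / 160 * n) * Real.exp (7 / 20 * (n : ℝ)) := by positivity
  nlinarith

/-- No decoder of short codes reconstructs the sign vectors of a large set with small
mean squared error. -/
theorem sum_decoding_error_ge {ι κ : Type*} [Fintype ι] [DecidableEq ι]
    (G : Finset (ι → Bool)) (hG : (2 : ℝ) ^ Fintype.card ι / 2 ≤ G.card) (Q : Finset κ) {B : ℕ}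
    (hQ : Q.card ≤ 4 ^ B) (hn : 25 ≤ Fintype.card ι) (hB : (B : ℝ) ≤ (Fintype.card ι : ℝ) / 32)
    (code : (ι → Bool) → κ) (hcode : ∀ ε ∈ G, code ε ∈ Q) (g : κ → ι → ℝ) :
    (G.card : ℝ) * (Fintype.card ι / 20) ≤
      ∑ ε ∈ G, ∑ p, (g (code ε) p - bitSign (ε p)) ^ 2 := by
  classical
  set n := Fintype.card ι with hn_def
  set near : (ι → Bool) → Prop := fun ε =>
    ∑ p, (g (code ε) p - bitSign (ε p)) ^ 2 ≤ (n : ℝ) / 10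
  have hsub : G.filter near ⊆ Q.biUnion fun q => Finset.univ.filter fun ε : ι → Bool =>
      ∑ p, (g q p - bitSign (ε p)) ^ 2 ≤ (n : ℝ) / 10 := by
    intro ε hε
    obtain ⟨h1, h2⟩ := Finset.mem_filter.1 hε
    exact Finset.mem_biUnion.2
      ⟨code ε, hcode ε h1, Finset.mem_filter.2 ⟨Finset.mem_univ _, h2⟩⟩
  have hbad : ((G.filter near).card : ℝ) ≤ 2 ^ n / 4 := by
    calc ((G.filter near).card : ℝ) ≤ ∑ q ∈ Q, ((Finset.univ.filter fun ε : ι → Bool =>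
          ∑ p, (g q p - bitSign (ε p)) ^ 2 ≤ (n : ℝ) / 10).card : ℝ) := by
            exact_mod_cast (Finset.card_le_card hsub).trans Finset.card_biUnion_le
      _ ≤ ∑ q ∈ Q, Real.exp (7 / 20 * n) := Finset.sum_le_sum fun q _ => card_signs_near_le (g q)
      _ = Q.card * Real.exp (7 / 20 * n) := by rw [Finset.sum_const, nsmul_eq_mul]
      _ ≤ 4 ^ B * Real.exp (7 / 20 * n) := by
            gcongr
            exact_mod_cast hQ
      _ ≤ _ := four_pow_mul_exp_le hn hB
  have hsplit : ((G.filter near).card : ℝ) + (G.filter fun ε => ¬ near ε).card = G.card := by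
    exact_mod_cast Finset.card_filter_add_card_filter_not (s := G) near
  have hfar : ((G.filter fun ε => ¬ near ε).card : ℝ) * (n / 10) ≤
      ∑ ε ∈ G, ∑ p, (g (code ε) p - bitSign (ε p)) ^ 2 := by
    rw [← nsmul_eq_mul, ← Finset.sum_const]
    refine (Finset.sum_le_sum fun ε hε => ?_).trans
      (Finset.sum_le_sum_of_subset_of_nonneg (Finset.filter_subset _ G)
        fun _ _ _ => Finset.sum_nonneg fun _ _ => sq_nonneg _)
    exact (not_le.1 (Finset.mem_filter.1 hε).2).le
  have hn0 : (0 : ℝ) ≤ n := Nat.cast_nonneg n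
  -- At most `2 ^ n / 4` members of `G` are near, which is at most half of `G`; each remaining one
  -- has error at least `n / 10`.
  nlinarith

/-! ### Counting joint messages -/

/-- The bit strings of length at most `L`. -/
def boundedLists : ℕ → Finset (List Bool)
  | 0 => {[]}
  | L + 1 => insert [] ((Finset.univ ×ˢ boundedLists L).image fun z : Bool × List Bool => z.1 :: z.2)

theorem mem_boundedLists {L : ℕ} {l : List Bool} (h : l.length ≤ L) : l ∈ boundedLists L := by
  induction L generalizing l with
  | zero => simp [boundedLists, List.eq_nil_of_length_eq_zero (Nat.le_zero.1 h)]
  | succ L ih =>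
    cases l with
    | nil => simp [boundedLists]
    | cons a l =>
      have := ih (l := l) (by simpa using h)
      simp [boundedLists, this]

/-- The crude base `4` makes the bound exactly `1` at length `0`, so a product over machines depends
only on the total length and not on the number of machines. -/
theorem card_boundedLists_le (L : ℕ) : (boundedLists L).card ≤ 4 ^ L := by
  induction L with
  | zero => simp [boundedLists]
  | succ L ih =>
    have h1 := Finset.card_insert_le ([] : List Bool)
      ((Finset.univ ×ˢ boundedLists L).image fun z : Bool × List Bool => z.1 :: z.2)
    have h2 := Finset.card_image_le (s := Finset.univ ×ˢ boundedLists L)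
      (f := fun z : Bool × List Bool => z.1 :: z.2)
    rw [Finset.card_product, Finset.card_univ, Fintype.card_bool] at h2
    have h3 : 1 ≤ 4 ^ L := Nat.one_le_pow _ _ (by norm_num)
    rw [boundedLists, pow_succ]
    omega

/-- If the total length of the messages is at most `B` for every choice of the inputs, the joint
message of machines sharing one input takes at most `4 ^ B` values. -/
theorem exists_codebook {μ X : Type*} [Fintype μ] [DecidableEq μ] (G : Finset X)
    (hG : G.Nonempty) (T : Finset μ) (msg : μ → X → List Bool) {B : ℕ}
    (hB : ∀ x : μ → X, (∀ i, x i ∈ G) → ∑ i ∈ T, (msg i (x i)).length ≤ B) :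
    ∃ Q : Finset (μ → List Bool), Q.card ≤ 4 ^ B ∧
      ∀ x ∈ G, (fun i => if i ∈ T then msg i x else []) ∈ Q := by
  -- Each machine gets the input with its own longest message. As `hB` allows different inputs on
  -- different machines, these maximal lengths still sum to at most `B`.
  have hmax : ∀ i, ∃ x ∈ G, ∀ y ∈ G, (msg i y).length ≤ (msg i x).length := fun i =>
    Finset.exists_max_image G (fun x => (msg i x).length) hG
  choose x hxG hx using hmax
  refine ⟨Fintype.piFinset fun i =>
    if i ∈ T then boundedLists (msg i (x i)).length else {[]}, ?_, fun y hy => ?_⟩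
  · rw [Fintype.card_piFinset]
    calc ∏ i, (if i ∈ T then boundedLists (msg i (x i)).length else {[]}).card
        ≤ ∏ i, (if i ∈ T then 4 ^ (msg i (x i)).length else 1) := by
          refine Finset.prod_le_prod' fun i _ => ?_
          split_ifs
          · exact card_boundedLists_le _
          · simp
      _ = 4 ^ ∑ i ∈ T, (msg i (x i)).length := by
          rw [Finset.prod_ite_mem, Finset.univ_inter, Finset.prod_pow_eq_pow_sum]
      _ ≤ 4 ^ B := Nat.pow_le_pow_right (by norm_num) (hB x hxG)
  · refine Fintype.mem_piFinset.2 fun i => ?_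
    split_ifs
    · exact mem_boundedLists (hx i y hy)
    · simp

/-! ### Sign operators and their inverses -/

section Operators

variable {E : Type*} [NormedAddCommGroup E] [InnerProductSpace ℝ E] [CompleteSpace E]

theorem ContinuousLinearMap.isSelfAdjoint_zero : IsSelfAdjoint (0 : E →L[ℝ] E) :=
  IsSelfAdjoint.zero _

theorem ContinuousLinearMap.isSelfAdjoint_smul_add_star (T : E →L[ℝ] E) (a : ℝ) :
    IsSelfAdjoint (a • (T + star T)) :=
  IsSelfAdjoint.smul (IsSelfAdjoint.all _) (IsSelfAdjoint.add_star_self _)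

theorem ContinuousLinearMap.norm_add_star_le (T : E →L[ℝ] E) : ‖T + star T‖ ≤ 2 * ‖T‖ := by
  refine (norm_add_le _ _).trans ?_
  have : ‖star T‖ = ‖T‖ := ContinuousLinearMap.adjoint.norm_map T
  linarith

end Operators

/-- The rescaled symmetrization of a triangular sign matrix. -/
noncomputable def signOp {d : ℕ} (ε : UpperPair d → Bool) :
    EuclideanSpace ℝ (Fin d) →L[ℝ] EuclideanSpace ℝ (Fin d) :=
  (96 * √d)⁻¹ • (Matrix.toEuclideanCLM (n := Fin d) (𝕜 := ℝ) (upperSignMatrix ε) +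
    star (Matrix.toEuclideanCLM (n := Fin d) (𝕜 := ℝ) (upperSignMatrix ε)))

theorem isSelfAdjoint_signOp {d : ℕ} (ε : UpperPair d → Bool) : IsSelfAdjoint (signOp ε) :=
  ContinuousLinearMap.isSelfAdjoint_smul_add_star _ _

theorem norm_signOp_le {d : ℕ} (hd : 0 < d) {ε : UpperPair d → Bool}
    (h : ‖Matrix.toEuclideanCLM (n := Fin d) (𝕜 := ℝ) (upperSignMatrix ε)‖ ≤ 12 * √d) :
    ‖signOp ε‖ ≤ 1 / 4 := by
  have hpos : 0 < √(d : ℝ) := Real.sqrt_pos.2 (by exact_mod_cast hd)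
  have h1 := ContinuousLinearMap.norm_add_star_le
    (Matrix.toEuclideanCLM (n := Fin d) (𝕜 := ℝ) (upperSignMatrix ε))
  rw [signOp, norm_smul, Real.norm_of_nonneg (by positivity), inv_mul_le_iff₀ (by positivity)]
  linarith

/-- Strictly above the diagonal the transpose contributes nothing, so the images of the basis
vectors display every sign. -/
theorem signOp_single_apply {d : ℕ} (ε : UpperPair d → Bool) (p : UpperPair d) :
    signOp ε (EuclideanSpace.single p.1.2 1) p.1.1 = (96 * √d)⁻¹ * bitSign (ε p) := by
  obtain ⟨⟨i, j⟩, hij⟩ := p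
  have hij' : i < j := hij
  rw [signOp, ← map_star, ← map_add]
  simp [upperSignMatrix, Matrix.star_eq_conjTranspose, hij', hij'.not_gt,
    Matrix.ofLp_toEuclideanCLM]

/-- The sign vectors whose triangular sign matrix has norm at most `12 √d`. -/
noncomputable def goodSigns (d : ℕ) : Finset (UpperPair d → Bool) :=
  Finset.univ.filter fun ε =>
    ‖Matrix.toEuclideanCLM (n := Fin d) (𝕜 := ℝ) (upperSignMatrix ε)‖ ≤ 12 * √d

theorem card_goodSigns_ge {d : ℕ} (hd : 1 ≤ d) :
    (2 : ℝ) ^ Fintype.card (UpperPair d) / 2 ≤ (goodSigns d).card := by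
  have h1 := card_upperSign_norm_gt_le hd
  have h2 := Finset.card_filter_add_card_filter_not (s := Finset.univ)
    fun ε : UpperPair d → Bool =>
      ‖Matrix.toEuclideanCLM (n := Fin d) (𝕜 := ℝ) (upperSignMatrix ε)‖ ≤ 12 * √d
  rw [Finset.card_univ, Fintype.card_fun, Fintype.card_bool] at h2
  have h3 : ((goodSigns d).card : ℝ) + ((Finset.univ.filter fun ε : UpperPair d → Bool =>
      ¬ ‖Matrix.toEuclideanCLM (n := Fin d) (𝕜 := ℝ) (upperSignMatrix ε)‖ ≤ 12 * √d).card : ℝ) =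
      2 ^ Fintype.card (UpperPair d) := by exact_mod_cast h2
  linarith

/-- The zero operator. -/
noncomputable def SmallSelfAdjoint.zero (d : ℕ) : SmallSelfAdjoint d :=
  ⟨0, ContinuousLinearMap.isSelfAdjoint_zero, by norm_num⟩

/-- The perturbation is defined through its inverse so that the minimizer, which involves `(1 +
R)⁻¹`, is affine in the signs. Outside `goodSigns` the value is a placeholder. -/
theorem exists_inverse_signOp {d : ℕ} (hd : 0 < d) :
    ∃ R : (UpperPair d → Bool) → SmallSelfAdjoint d,
      ∀ ε ∈ goodSigns d, (1 + (R ε).1) * (1 + signOp ε) = 1 := by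
  have h : ∀ ε : UpperPair d → Bool, ∃ R : SmallSelfAdjoint d,
      ε ∈ goodSigns d → (1 + R.1) * (1 + signOp ε) = 1 := by
    intro ε
    by_cases hε : ε ∈ goodSigns d
    · obtain ⟨R, h1, h2, h3⟩ := exists_selfAdjoint_inverse (isSelfAdjoint_signOp ε)
        (norm_signOp_le hd (Finset.mem_filter.1 hε).2)
      exact ⟨⟨R, h1, h2⟩, fun _ => h3⟩
    · exact ⟨SmallSelfAdjoint.zero d, fun h => absurd h hε⟩
  choose R hR using h
  exact ⟨R, hR⟩

/-! ### Hard families and their minimizers -/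

open scoped RealInnerProductSpace in
/-- Completing the square in a quadratic function with minimizer `z`. -/
theorem quadratic_sub_eq {E : Type*} [NormedAddCommGroup E] [InnerProductSpace ℝ E]
    [CompleteSpace E] {R : E →L[ℝ] E} (hR : IsSelfAdjoint R) {lam : ℝ} {b z : E}
    (hz : b = -(4 * lam) • (z + R z)) (w : E) :
    (2 * lam * ‖w‖ ^ 2 + 2 * lam * ⟪w, R w⟫ + ⟪b, w⟫) -
      (2 * lam * ‖z‖ ^ 2 + 2 * lam * ⟪z, R z⟫ + ⟪b, z⟫) =
      2 * lam * (‖w - z‖ ^ 2 + ⟪w - z, R (w - z)⟫) := by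
  subst hz
  simp only [← real_inner_self_eq_norm_sq, inner_smul_left, inner_add_left, inner_sub_left,
    inner_sub_right, map_sub, conj_trivial]
  rw [real_inner_comm w z, real_inner_comm w (R z), real_inner_comm z (R z),
    hR.inner_apply_comm z w]
  ring

/-- The machines in `T` hold quadratic forms, the others the linear term `δ e_j`. -/
noncomputable def hardFamily {m d : ℕ} {lam : ℝ} (hlam : 0 ≤ lam) (δ : ℝ) (T : Finset (Fin m))
    (r : Fin m → SmallSelfAdjoint d) (j : Fin d) : Fin m → QuadraticFn d := fun i =>
  if i ∈ T then hardQuadratic hlam (r i) 0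
  else hardQuadratic hlam (SmallSelfAdjoint.zero d) (δ • EuclideanSpace.single j 1)

theorem norm_smul_single {d : ℕ} {δ : ℝ} (hδ : 0 ≤ δ) (j : Fin d) :
    ‖δ • (EuclideanSpace.single j 1 : EuclideanSpace ℝ (Fin d))‖ = δ := by
  rw [norm_smul, PiLp.norm_single, Real.norm_of_nonneg hδ]
  simp

theorem hardFamily_admissible {m d : ℕ} {lam δ : ℝ} (hlam : 0 ≤ lam) (hδ : 3 * lam ≤ δ)
    (T : Finset (Fin m)) (r : Fin m → SmallSelfAdjoint d) (j : Fin d) :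
    IsAdmissible δ lam (9 * lam) (hardFamily hlam δ T r j) := by
  have hδ0 : 0 ≤ δ := by linarith
  have hn := norm_smul_single hδ0 j
  refine ⟨fun i k => ?_, fun i => ?_⟩
  · unfold hardFamily
    split_ifs <;> refine hardQuadratic_related hlam hδ _ _ ?_ <;> simp [hn, hδ0]
  · unfold hardFamily
    split_ifs <;> exact hardQuadratic_regular hlam _ _

-- The two groups have equal size, so averaging halves both `2R` and `δ e_j`.
open scoped RealInnerProductSpace in
theorem averageFn_hardFamily {m d : ℕ} {lam : ℝ} (hlam : 0 ≤ lam) (δ : ℝ) {T : Finset (Fin m)}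
    (hm : 0 < m) (hT : 2 * T.card = m) (R : SmallSelfAdjoint d) (j : Fin d)
    (w : EuclideanSpace ℝ (Fin d)) :
    averageFn (hardFamily hlam δ T (fun _ => R) j) w =
      2 * lam * ‖w‖ ^ 2 + 2 * lam * ⟪w, R.1 w⟫ +
        ⟪(δ / 2) • (EuclideanSpace.single j 1 : EuclideanSpace ℝ (Fin d)), w⟫ := by
  have h0 : ⟪w, (SmallSelfAdjoint.zero d).1 w⟫ = 0 := by simp [SmallSelfAdjoint.zero]
  have hc : ((Finset.univ.filter fun i => i ∉ T).card : ℝ) = T.card := by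
    have h := Finset.card_filter_add_card_filter_not (s := Finset.univ) fun i => i ∈ T
    rw [Finset.card_univ, Fintype.card_fin, Finset.filter_univ_mem] at h
    have : (Finset.univ.filter fun i => i ∉ T).card = T.card := by omega
    rw [this]
  have hm' : (m : ℝ) = 2 * T.card := by exact_mod_cast hT.symm
  have hT0 : (T.card : ℝ) ≠ 0 := by
    have : 0 < T.card := by omega
    positivity
  simp only [averageFn, hardFamily, apply_ite (fun q : QuadraticFn d => q.eval w),
    hardQuadratic_eval, Finset.sum_ite, Finset.sum_const, nsmul_eq_mul, hc, h0,
    Finset.filter_univ_mem, hm', inner_zero_left, inner_smul_left, conj_trivial]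
  field_simp
  ring

/-- The minimizer of the average of a hard family. -/
noncomputable def hardMinimizer {d : ℕ} (lam δ : ℝ) (ε : UpperPair d → Bool) (j : Fin d) :
    EuclideanSpace ℝ (Fin d) :=
  (-(δ / (8 * lam))) • (1 + signOp ε) (EuclideanSpace.single j 1)

open scoped RealInnerProductSpace in
theorem averageFn_hardFamily_sub {m d : ℕ} {lam : ℝ} (hlam : 0 < lam) (δ : ℝ)
    {T : Finset (Fin m)} (hm : 0 < m) (hT : 2 * T.card = m) {R : SmallSelfAdjoint d}
    {ε : UpperPair d → Bool} (hR : (1 + R.1) * (1 + signOp ε) = 1) (j : Fin d)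
    (w : EuclideanSpace ℝ (Fin d)) :
    averageFn (hardFamily hlam.le δ T (fun _ => R) j) w -
      averageFn (hardFamily hlam.le δ T (fun _ => R) j) (hardMinimizer lam δ ε j) =
      2 * lam * (‖w - hardMinimizer lam δ ε j‖ ^ 2 +
        ⟪w - hardMinimizer lam δ ε j, R.1 (w - hardMinimizer lam δ ε j)⟫) := by
  rw [averageFn_hardFamily hlam.le δ hm hT, averageFn_hardFamily hlam.le δ hm hT]
  refine quadratic_sub_eq R.2.1 ?_ w
  have h1 : hardMinimizer lam δ ε j + R.1 (hardMinimizer lam δ ε j) =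
      (1 + R.1) (hardMinimizer lam δ ε j) := rfl
  have h2 : (1 + R.1) ((1 + signOp ε) (EuclideanSpace.single j 1)) = EuclideanSpace.single j 1 :=
    DFunLike.congr_fun hR _
  rw [h1, hardMinimizer, map_smul, h2, smul_smul]
  congr 1
  field_simp
  ring

theorem averageFn_hardFamily_sub_ge {m d : ℕ} {lam : ℝ} (hlam : 0 < lam) (δ : ℝ)
    {T : Finset (Fin m)} (hm : 0 < m) (hT : 2 * T.card = m) {R : SmallSelfAdjoint d}
    {ε : UpperPair d → Bool} (hR : (1 + R.1) * (1 + signOp ε) = 1) (j : Fin d)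
    (w : EuclideanSpace ℝ (Fin d)) :
    4 / 3 * lam * ‖w - hardMinimizer lam δ ε j‖ ^ 2 ≤
      averageFn (hardFamily hlam.le δ T (fun _ => R) j) w -
      averageFn (hardFamily hlam.le δ T (fun _ => R) j) (hardMinimizer lam δ ε j) := by
  rw [averageFn_hardFamily_sub hlam δ hm hT hR]
  have := (abs_le.1 (R.abs_inner_le (w - hardMinimizer lam δ ε j))).1
  nlinarith

theorem averageFn_hardFamily_sub_le {m d : ℕ} {lam : ℝ} (hlam : 0 < lam) (δ : ℝ)
    {T : Finset (Fin m)} (hm : 0 < m) (hT : 2 * T.card = m) {R : SmallSelfAdjoint d}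
    {ε : UpperPair d → Bool} (hR : (1 + R.1) * (1 + signOp ε) = 1) (j : Fin d)
    (w : EuclideanSpace ℝ (Fin d)) :
    averageFn (hardFamily hlam.le δ T (fun _ => R) j) w -
      averageFn (hardFamily hlam.le δ T (fun _ => R) j) (hardMinimizer lam δ ε j) ≤
      8 / 3 * lam * ‖w - hardMinimizer lam δ ε j‖ ^ 2 := by
  rw [averageFn_hardFamily_sub hlam δ hm hT hR]
  have := (abs_le.1 (R.abs_inner_le (w - hardMinimizer lam δ ε j))).2
  nlinarith

theorem norm_hardMinimizer_le {d : ℕ} {lam δ : ℝ} (hlam : 0 < lam) (hδ : 0 ≤ δ) (hd : 0 < d)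
    {ε : UpperPair d → Bool} (hε : ε ∈ goodSigns d) (j : Fin d) :
    ‖hardMinimizer lam δ ε j‖ ≤ δ / (2 * lam) := by
  have h1 : ‖(1 + signOp ε) (EuclideanSpace.single j 1)‖ ≤ 4 := by
    have h2 := (signOp ε).le_of_opNorm_le (norm_signOp_le hd (Finset.mem_filter.1 hε).2)
      (EuclideanSpace.single j 1)
    have h3 := norm_add_le (EuclideanSpace.single j (1 : ℝ))
      (signOp ε (EuclideanSpace.single j 1))
    have h4 : ‖(EuclideanSpace.single j 1 : EuclideanSpace ℝ (Fin d))‖ = 1 := by simp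
    rw [h4] at h2 h3
    exact h3.trans (by linarith)
  have h5 : 0 ≤ δ / (8 * lam) := by positivity
  rw [hardMinimizer, norm_smul, norm_neg, Real.norm_of_nonneg h5]
  calc δ / (8 * lam) * ‖(1 + signOp ε) (EuclideanSpace.single j 1)‖ ≤ δ / (8 * lam) * 4 := by
        gcongr
    _ = δ / (2 * lam) := by field_simp; ring

open scoped RealInnerProductSpace in
theorem hardQuadratic_eval_nonneg {d : ℕ} {lam : ℝ} (hlam : 0 ≤ lam) (R : SmallSelfAdjoint d)
    (w : EuclideanSpace ℝ (Fin d)) :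
    lam / 2 * ‖w‖ ^ 2 ≤ (hardQuadratic hlam R 0).eval w := by
  rw [hardQuadratic_eval, inner_zero_left, add_zero, ← inner_hessianOp]
  exact hessianOp_lower hlam R w

open scoped RealInnerProductSpace in
theorem hardQuadratic_zero_eval {d : ℕ} {lam : ℝ} (hlam : 0 ≤ lam)
    (b w : EuclideanSpace ℝ (Fin d)) :
    (hardQuadratic hlam (SmallSelfAdjoint.zero d) b).eval w = 2 * lam * ‖w‖ ^ 2 + ⟪b, w⟫ := by
  have h0 : ⟪w, (SmallSelfAdjoint.zero d).1 w⟫ = 0 := by simp [SmallSelfAdjoint.zero]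
  rw [hardQuadratic_eval, h0, mul_zero, add_zero]

theorem exists_isMinOn_hardFamily {m d : ℕ} {lam : ℝ} (hlam : 0 < lam) (δ : ℝ)
    (T : Finset (Fin m)) (r : Fin m → SmallSelfAdjoint d) (j : Fin d) (i : Fin m) :
    ∃ v, IsMinOn (hardFamily hlam.le δ T r j i).eval Set.univ v := by
  unfold hardFamily
  split_ifs
  · refine ⟨0, fun w _ => ?_⟩
    have h1 := hardQuadratic_eval_nonneg hlam.le (r i) w
    have h2 : (hardQuadratic hlam.le (r i) 0).eval 0 = 0 := by
      rw [hardQuadratic_eval]; simp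
    simp only [Set.mem_ofPred_eq, h2]
    exact le_trans (by positivity) h1
  · set b : EuclideanSpace ℝ (Fin d) := δ • EuclideanSpace.single j 1
    refine ⟨-(4 * lam)⁻¹ • b, fun w _ => ?_⟩
    simp only [Set.mem_ofPred_eq, hardQuadratic_zero_eval]
    have h := quadratic_sub_eq (R := 0) ContinuousLinearMap.isSelfAdjoint_zero (lam := lam) (b := b)
      (z := -(4 * lam)⁻¹ • b) (by
        rw [zero_apply, add_zero, smul_smul, neg_mul_neg,
          mul_inv_cancel₀ (by positivity), one_smul]) w
    simp only [zero_apply, inner_zero_right, mul_zero, add_zero] at h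
    have : 0 ≤ 2 * lam * ‖w - -(4 * lam)⁻¹ • b‖ ^ 2 := by positivity
    linarith

/-- Compare with the value at `0`: a machine in `T` is minimized only there, and for the others
`2λ‖v‖² ≤ δ‖v‖`. -/
theorem norm_le_of_isMinOn_hardFamily {m d : ℕ} {lam δ : ℝ} (hlam : 0 < lam) (hδ : 0 ≤ δ)
    (T : Finset (Fin m)) (r : Fin m → SmallSelfAdjoint d) (j : Fin d) (i : Fin m)
    {v : EuclideanSpace ℝ (Fin d)}
    (hv : IsMinOn (hardFamily hlam.le δ T r j i).eval Set.univ v) : ‖v‖ ≤ δ / (2 * lam) := by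
  have h := hv (Set.mem_univ 0)
  rw [le_div_iff₀ (by positivity)]
  unfold hardFamily at h
  split_ifs at h
  · have h1 := hardQuadratic_eval_nonneg hlam.le (r i) v
    have h2 : (hardQuadratic hlam.le (r i) 0).eval 0 = 0 := by
      rw [hardQuadratic_eval]; simp
    simp only [Set.mem_ofPred_eq, h2] at h
    have h3 : ‖v‖ = 0 := by
      by_contra hne
      have : 0 < lam / 2 * ‖v‖ ^ 2 := by positivity
      linarith
    rw [h3, zero_mul]
    exact hδ
  · simp only [Set.mem_ofPred_eq, hardQuadratic_zero_eval, inner_zero_right, norm_zero] at h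
    have h1 := neg_le_of_abs_le (abs_real_inner_le_norm
      (δ • (EuclideanSpace.single j 1 : EuclideanSpace ℝ (Fin d))) v)
    rw [norm_smul_single hδ] at h1
    by_contra! hcon
    have hpos : 0 < ‖v‖ := by
      by_contra! h0
      have : ‖v‖ = 0 := le_antisymm h0 (norm_nonneg v)
      rw [this] at hcon
      linarith
    nlinarith

theorem continuous_averageFn_hardFamily {m d : ℕ} {lam : ℝ} (hlam : 0 ≤ lam) (δ : ℝ)
    {T : Finset (Fin m)} (hm : 0 < m) (hT : 2 * T.card = m) (R : SmallSelfAdjoint d)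
    (j : Fin d) : Continuous (averageFn (hardFamily hlam δ T (fun _ => R) j)) := by
  rw [funext fun w => averageFn_hardFamily hlam δ hm hT R j w]
  fun_prop

/-- The squared distance to the minimizer, bounded below through the coordinates above the
diagonal. -/
theorem norm_sub_hardMinimizer_sq_ge {d : ℕ} (hd : 0 < d) {lam δ : ℝ} (hlam : 0 < lam)
    (hδ : 0 < δ) (ε : UpperPair d → Bool) (w : Fin d → EuclideanSpace ℝ (Fin d)) :
    (δ / (8 * lam)) ^ 2 * ((96 ^ 2 * (d : ℝ))⁻¹ * ∑ p : UpperPair d,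
      (-(8 * lam / δ) * (96 * √d) * w p.1.2 p.1.1 - bitSign (ε p)) ^ 2) ≤
      ∑ j, ‖w j - hardMinimizer lam δ ε j‖ ^ 2 := by
  have hpos : 0 < √(d : ℝ) := Real.sqrt_pos.2 (by exact_mod_cast hd)
  have hsq : √(d : ℝ) ^ 2 = d := Real.sq_sqrt (Nat.cast_nonneg d)
  have hp : ∀ p : UpperPair d, (δ / (8 * lam)) ^ 2 * ((96 ^ 2 * (d : ℝ))⁻¹ *
      (-(8 * lam / δ) * (96 * √d) * w p.1.2 p.1.1 - bitSign (ε p)) ^ 2) =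
      ((w p.1.2 - hardMinimizer lam δ ε p.1.2) p.1.1) ^ 2 := by
    intro p
    have hne : p.1.1 ≠ p.1.2 := p.2.ne
    have h1 : hardMinimizer lam δ ε p.1.2 p.1.1 =
        -(δ / (8 * lam)) * ((96 * √d)⁻¹ * bitSign (ε p)) := by
      rw [← signOp_single_apply]
      simp [hardMinimizer, hne]
    rw [PiLp.sub_apply, h1]
    generalize √(d : ℝ) = s at hpos hsq ⊢
    rw [← hsq]
    field_simp
    ring
  rw [Finset.mul_sum, Finset.mul_sum, Finset.sum_congr rfl fun p _ => hp p, sum_upperPair]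
  refine Finset.sum_le_sum fun j _ => ?_
  rw [EuclideanSpace.real_norm_sq_eq]
  refine Finset.sum_le_sum fun i _ => ?_
  split_ifs
  · exact le_rfl
  · positivity

/-! ### From decoding error to suboptimality -/

/-- For a fixed seed, the total suboptimality over the hard families is large. -/
theorem sum_gap_ge {m d : ℕ} {Ω : Type*} (hd : 10 ≤ d) {lam δ : ℝ} (hlam : 0 < lam)
    (hδ : 3 * lam ≤ δ) (alg : OneRoundAlgorithm m d Ω) (ω : Ω)
    (hbits : ∀ F : Fin m → QuadraticFn d, IsAdmissible δ lam (9 * lam) F →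
      (alg.bits F ω : ℝ) ≤ (d : ℝ) ^ 2 / 128)
    {T : Finset (Fin m)} (hT : 2 * T.card = m) (hdes : alg.designated ∉ T)
    {R : (UpperPair d → Bool) → SmallSelfAdjoint d}
    (hR : ∀ ε ∈ goodSigns d, (1 + (R ε).1) * (1 + signOp ε) = 1) :
    ((goodSigns d).card * d : ℝ) * (1 / 10 ^ 8 * δ ^ 2 / lam) ≤
      ∑ ε ∈ goodSigns d, ∑ j,
        (averageFn (hardFamily hlam.le δ T (fun _ => R ε) j)
          (alg.run (hardFamily hlam.le δ T (fun _ => R ε) j) ω) -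
        averageFn (hardFamily hlam.le δ T (fun _ => R ε) j) (hardMinimizer lam δ ε j)) := by
  have hδ0 : 0 < δ := by linarith
  have hm : 0 < m := alg.designated.pos
  have hd0 : 0 < d := by omega
  have hdR : (10 : ℝ) ≤ d := by exact_mod_cast hd
  have hn := card_upperPair_lower (d := d) (by omega)
  have hn25 : 25 ≤ Fintype.card (UpperPair d) := by
    have : (25 : ℝ) ≤ Fintype.card (UpperPair d) := by nlinarith
    exact_mod_cast this
  have hcard := card_goodSigns_ge (d := d) (by omega)
  have hne : (goodSigns d).Nonempty := by
    rw [← Finset.card_pos]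
    have : (0 : ℝ) < (goodSigns d).card := lt_of_lt_of_le (by positivity) hcard
    exact_mod_cast this
  -- The communication bound is applied to families whose machines in `T` hold different operators.
  -- The index `j = 0` is arbitrary, as messages from `T` do not depend on it.
  obtain ⟨Q, hQ, hcode⟩ := exists_codebook (B := ⌊(d : ℝ) ^ 2 / 128⌋₊) (goodSigns d) hne T
    (fun i ε => alg.message i (hardQuadratic hlam.le (R ε) 0) ω) (by
      intro x _
      have h := hbits _ (hardFamily_admissible hlam.le hδ T (fun i => R (x i)) ⟨0, hd0⟩)
      rw [← Nat.le_floor_iff (by positivity)] at h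
      refine le_trans ?_ h
      rw [OneRoundAlgorithm.bits]
      refine le_trans (Finset.sum_le_sum fun i hi => ?_)
        (Finset.sum_le_sum_of_subset (Finset.subset_univ T))
      simp only [hardFamily, if_pos hi, le_refl])
  have hB : ((⌊(d : ℝ) ^ 2 / 128⌋₊ : ℕ) : ℝ) ≤ (Fintype.card (UpperPair d) : ℝ) / 32 :=
    (Nat.floor_le (by positivity)).trans (by linarith)
  let held : Fin d → QuadraticFn d := fun j =>
    hardQuadratic hlam.le (SmallSelfAdjoint.zero d) (δ • EuclideanSpace.single j 1)
  -- Everything outside `T`, the designated machine included, depends on `j` alone, so the decoder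
  -- simulates it knowing only the messages from `T`.
  let dec : (Fin m → List Bool) → Fin d → EuclideanSpace ℝ (Fin d) := fun q j =>
    alg.output (held j) (fun i => if i ∈ T then q i else alg.message i (held j) ω) ω
  let code : (UpperPair d → Bool) → Fin m → List Bool := fun ε i =>
    if i ∈ T then alg.message i (hardQuadratic hlam.le (R ε) 0) ω else []
  have hrun : ∀ ε j, alg.run (hardFamily hlam.le δ T (fun _ => R ε) j) ω = dec (code ε) j := by
    intro ε j
    simp only [OneRoundAlgorithm.run, dec, hardFamily, if_neg hdes, held, code]
    congr 1
    funext i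
    split_ifs <;> rfl
  have hdecode := sum_decoding_error_ge (goodSigns d) hcard Q hQ hn25 hB code hcode
    -- This factor undoes the scaling of the minimizer's off-diagonal entries, turning output
    -- coordinates into estimates of signs.
    fun q p => -(8 * lam / δ) * (96 * √d) * dec q p.1.2 p.1.1
  have hgap : ∀ ε ∈ goodSigns d, 4 / 3 * lam * ((δ / (8 * lam)) ^ 2 * ((96 ^ 2 * (d : ℝ))⁻¹ *
      ∑ p : UpperPair d, (-(8 * lam / δ) * (96 * √d) * dec (code ε) p.1.2 p.1.1 -
        bitSign (ε p)) ^ 2)) ≤ ∑ j,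
        (averageFn (hardFamily hlam.le δ T (fun _ => R ε) j)
          (alg.run (hardFamily hlam.le δ T (fun _ => R ε) j) ω) -
        averageFn (hardFamily hlam.le δ T (fun _ => R ε) j) (hardMinimizer lam δ ε j)) := by
    intro ε hε
    refine (mul_le_mul_of_nonneg_left (norm_sub_hardMinimizer_sq_ge hd0 hlam hδ0 ε
      (dec (code ε))) (by positivity)).trans ?_
    rw [Finset.mul_sum]
    refine Finset.sum_le_sum fun j _ => ?_
    rw [hrun]
    exact averageFn_hardFamily_sub_ge hlam δ hm hT (hR ε hε) j _
  refine le_trans ?_ (Finset.sum_le_sum hgap)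
  simp only [← Finset.mul_sum]
  refine le_trans ?_ (mul_le_mul_of_nonneg_left (mul_le_mul_of_nonneg_left
    (mul_le_mul_of_nonneg_left hdecode (by positivity)) (by positivity)) (by positivity))
  -- With `n ≥ d²/4` the error per sign vector is `d²/80`; dividing by `96² d` leaves a multiple of
  -- `d`, that is, a constant per column.
  calc ((goodSigns d).card * d : ℝ) * (1 / 10 ^ 8 * δ ^ 2 / lam)
      ≤ ((goodSigns d).card * d : ℝ) * (4 / 3 / (64 * 96 ^ 2 * 80) * δ ^ 2 / lam) := by
        gcongr <;> norm_num
    _ = 4 / 3 * lam * ((δ / (8 * lam)) ^ 2 * ((96 ^ 2 * (d : ℝ))⁻¹ *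
        ((goodSigns d).card * ((d : ℝ) ^ 2 / 4 / 20)))) := by
        field_simp
        ring
    _ ≤ _ := by gcongr

/-- The bound on the sum holds for each seed, so it survives integration, and some term is at least
the average. The index is thus chosen independently of the seed. -/
theorem exists_lintegral_ge_of_sum_ge {Ω ι : Type*} [MeasurableSpace Ω]
    (P : MeasureTheory.Measure Ω) [MeasureTheory.IsProbabilityMeasure P] {s : Finset ι}
    (hs : s.Nonempty) {f : ι → Ω → ℝ} (hf : ∀ i ∈ s, Measurable (f i))
    (hf0 : ∀ i ∈ s, ∀ ω, 0 ≤ f i ω) {C : ℝ} (hC : ∀ ω, (s.card : ℝ) * C ≤ ∑ i ∈ s, f i ω) :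
    ∃ i ∈ s, ENNReal.ofReal C ≤ ∫⁻ ω, ENNReal.ofReal (f i ω) ∂P := by
  by_contra! hcon
  have h1 : ∑ i ∈ s, ∫⁻ ω, ENNReal.ofReal (f i ω) ∂P < ∑ _i ∈ s, ENNReal.ofReal C :=
    ENNReal.sum_lt_sum_of_nonempty hs hcon
  rw [← MeasureTheory.lintegral_finsetSum' s fun i hi => (hf i hi).ennreal_ofReal.aemeasurable,
    Finset.sum_const, nsmul_eq_mul, ← ENNReal.ofReal_natCast,
    ← ENNReal.ofReal_mul (Nat.cast_nonneg _)] at h1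
  refine absurd h1 (not_lt.2 ?_)
  calc ENNReal.ofReal (s.card * C) = ∫⁻ _, ENNReal.ofReal (s.card * C) ∂P := by simp
    _ ≤ _ := by
      refine MeasureTheory.lintegral_mono fun ω => ?_
      rw [← ENNReal.ofReal_sum_of_nonneg fun i hi => hf0 i hi ω]
      exact ENNReal.ofReal_le_ofReal (hC ω)

theorem theorem3 :
    ∃ (c c' : ℝ) (d₀ : ℕ), 0 < c ∧ 0 < c' ∧
      ∀ (m d : ℕ), Even m → d₀ < d →
      ∀ (δ lam : ℝ), 0 < lam → 3 * lam ≤ δ →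
      ∀ (Ω : Type*) [MeasurableSpace Ω] (P : MeasureTheory.Measure Ω)
        [MeasureTheory.IsProbabilityMeasure P] (alg : OneRoundAlgorithm m d Ω),
      (∀ F : Fin m → QuadraticFn d, IsAdmissible δ lam (9 * lam) F →
        Measurable (alg.run F) ∧ ∀ ω : Ω, (alg.bits F ω : ℝ) ≤ (d : ℝ) ^ 2 / 128) →
      ∃ F : Fin m → QuadraticFn d, IsAdmissible δ lam (9 * lam) F ∧
        ∃ wstar : EuclideanSpace ℝ (Fin d), IsMinOn (averageFn F) Set.univ wstar ∧
          ENNReal.ofReal (c * δ ^ 2 / lam) ≤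
            ∫⁻ ω, ENNReal.ofReal (averageFn F (alg.run F ω) - averageFn F wstar) ∂P ∧
          ∀ j : Fin m,
            (∃ v : EuclideanSpace ℝ (Fin d), IsMinOn (F j).eval Set.univ v) ∧
            ∀ v : EuclideanSpace ℝ (Fin d), IsMinOn (F j).eval Set.univ v →
              averageFn F v - averageFn F wstar ≤ c' * δ ^ 2 / lam := by
  refine ⟨1 / 10 ^ 8, 8 / 3, 10, by norm_num, by norm_num, ?_⟩
  intro m d hmeven hd δ lam hlam hδ Ω _ P _ alg halg
  have hδ0 : 0 ≤ δ := by linarith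
  have hm : 0 < m := alg.designated.pos
  have hd0 : 0 < d := by omega
  obtain ⟨k, hk⟩ := hmeven
  -- The group carrying the signs avoids the designated machine, which would otherwise know them
  -- without communication.
  obtain ⟨T, hTsub, hTcard⟩ := Finset.exists_subset_card_eq
    (s := Finset.univ.erase alg.designated) (n := k) (by
      rw [Finset.card_erase_of_mem (Finset.mem_univ _), Finset.card_univ, Fintype.card_fin]
      omega)
  have hdes : alg.designated ∉ T := fun h => Finset.notMem_erase _ _ (hTsub h)
  have hT : 2 * T.card = m := by omega
  obtain ⟨R, hR⟩ := exists_inverse_signOp hd0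
  have hadm := fun ε j => hardFamily_admissible hlam.le hδ T (fun _ => R ε) j
  have hsum := fun ω => sum_gap_ge hd.le hlam hδ alg ω (fun F hF => (halg F hF).2 ω) hT hdes hR
  have hne : (goodSigns d).Nonempty := by
    rw [← Finset.card_pos]
    have : (0 : ℝ) < (goodSigns d).card :=
      lt_of_lt_of_le (by positivity) (card_goodSigns_ge (d := d) (by omega))
    exact_mod_cast this
  have : Nonempty (Fin d) := ⟨⟨0, hd0⟩⟩
  have hgap0 : ∀ ε ∈ goodSigns d, ∀ j w, 0 ≤
      averageFn (hardFamily hlam.le δ T (fun _ => R ε) j) w -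
      averageFn (hardFamily hlam.le δ T (fun _ => R ε) j) (hardMinimizer lam δ ε j) :=
    fun ε hε j w => le_trans (by positivity)
      (averageFn_hardFamily_sub_ge hlam δ hm hT (hR ε hε) j w)
  obtain ⟨⟨ε, j⟩, hmem, hint⟩ := exists_lintegral_ge_of_sum_ge P
    (s := goodSigns d ×ˢ (Finset.univ : Finset (Fin d)))
    (f := fun z ω => averageFn (hardFamily hlam.le δ T (fun _ => R z.1) z.2)
          (alg.run (hardFamily hlam.le δ T (fun _ => R z.1) z.2) ω) -
        averageFn (hardFamily hlam.le δ T (fun _ => R z.1) z.2) (hardMinimizer lam δ z.1 z.2))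
    (hne.product Finset.univ_nonempty)
    (fun z _ => ((continuous_averageFn_hardFamily hlam.le δ hm hT (R z.1) z.2).measurable.comp
      (halg _ (hadm z.1 z.2)).1).sub_const _)
    (fun z hz ω => hgap0 z.1 (Finset.mem_product.1 hz).1 z.2 _)
    (C := 1 / 10 ^ 8 * δ ^ 2 / lam) (fun ω => by
      rw [Finset.sum_product, Finset.card_product, Finset.card_univ, Fintype.card_fin,
        Nat.cast_mul]
      exact hsum ω)
  have hε : ε ∈ goodSigns d := (Finset.mem_product.1 hmem).1
  refine ⟨hardFamily hlam.le δ T (fun _ => R ε) j, hadm ε j, hardMinimizer lam δ ε j,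
    fun w _ => sub_nonneg.1 (hgap0 ε hε j w), hint, fun i =>
    ⟨exists_isMinOn_hardFamily hlam δ T _ j i, fun v hv => ?_⟩⟩
  refine (averageFn_hardFamily_sub_le hlam δ hm hT (hR ε hε) j v).trans ?_
  have h1 := norm_le_of_isMinOn_hardFamily hlam hδ0 T _ j i hv
  have h2 := norm_hardMinimizer_le hlam hδ0 hd0 hε j
  have h3 : ‖v - hardMinimizer lam δ ε j‖ ≤ δ / lam := by
    refine (norm_sub_le _ _).trans ((add_le_add h1 h2).trans (le_of_eq ?_))
    field_simp
    ring
  calc 8 / 3 * lam * ‖v - hardMinimizer lam δ ε j‖ ^ 2 ≤ 8 / 3 * lam * (δ / lam) ^ 2 := by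
        gcongr
    _ = 8 / 3 * δ ^ 2 / lam := by field_simp
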